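/- For a group $G$ and an integer $q\ge 1$ write $x^y=y^{-1}xy$ and $[x,y]=x^{-1}y^{-1}xy$. The $q$-tensor square $G\otimes^q G$ is the group generated by the symbols $g\otimes h$ and $\widehat{k}$ ($g,h,k\in G$) subject to the following relations, for all $g,g_1,h,h_1,k,k_1\in G$: $$g\otimes hh_1=(g\otimes h_1)(g^{h_1}\otimes h^{h_1}),\qquad gg_1\otimes h=(g^{g_1}\otimes h^{g_1})(g_1\otimes h),$$ $$(g\otimes h)^{\widehat{k}}=g^{(k^q)}\otimes h^{(k^q)},\qquad \widehat{kk_1}=\widehat{k}\,\Bigl(\prod_{i=1}^{q-1}\bigl(k\otimes (k_1^{-i})^{k^{q-1-i}}\bigr)\Bigr)\,\widehat{k_1},$$ $$[\widehat{k},\widehat{k_1}]=k^q\otimes k_1^q,\qquad \widehat{[g,h]}=(g\otimes h)^q,$$ where the product is taken in increasing order of $i$ from left to right. **Proposition.** Let $n\ge 1$, let $q\ge 1$ be odd, and let $D_n$ be the dihedral group of order $2n$. Then $D_n\otimes^q D_n\cong D_n$, and the second homology group $H_2(D_n,\mathbb{Z}_q)$ of $D_n$ with coefficients in the trivial module $\mathbb{Z}_q=\mathbb{Z}/q\mathbb{Z}$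 is trivial. -/

import Mathlib

/-- Conjugation `x ^ y = y⁻¹ x y`. -/
def rconj {G : Type*} [Group G] (x y : G) : G := y⁻¹ * x * y

/-- The commutator `[x, y] = x⁻¹ y⁻¹ x y`. -/
def rcomm {G : Type*} [Group G] (x y : G) : G := x⁻¹ * y⁻¹ * x * y

/-- The symbols `g ⊗ h` and `k̂` (`g, h, k ∈ G`) generating the `q`-tensor square of `G`. -/
inductive QTensorGen (G : Type*) : Type _
  | tensor (g h : G) : QTensorGen G
  | hat (k : G) : QTensorGen G

namespace QTensorSquare

/-- The symbol `g ⊗ h`, as an element of the free group. -/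
def tens {G : Type*} (g h : G) : FreeGroup (QTensorGen G) := FreeGroup.of (QTensorGen.tensor g h)

/-- The symbol `k̂`, as an element of the free group. -/
def hat {G : Type*} (k : G) : FreeGroup (QTensorGen G) := FreeGroup.of (QTensorGen.hat k)

/-- The ordered product `∏_{i = 1}^{q - 1} (k ⊗ (k₁⁻ⁱ) ^ (k ^ (q - 1 - i)))`, with `i` increasing
from left to right. -/
def hatProd {G : Type*} [Group G] (q : ℕ) (k k₁ : G) : FreeGroup (QTensorGen G) :=
  ((List.range (q - 1)).map fun j =>
    tens k (rconj ((k₁ ^ (j + 1))⁻¹) (k ^ (q - 1 - (j + 1))))).prod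

/-- The defining relators of the `q`-tensor square; the relation `u = v` is the relator `u * v⁻¹`.
For `q = 0` the last constructor removes the symbols `k̂`, leaving the non-abelian tensor square. -/
inductive IsRelator {G : Type*} [Group G] (q : ℕ) : FreeGroup (QTensorGen G) → Prop
  | tensor_mul (g h h₁ : G) :
      IsRelator q (tens g (h * h₁) * (tens g h₁ * tens (rconj g h₁) (rconj h h₁))⁻¹)
  | mul_tensor (g g₁ h : G) :
      IsRelator q (tens (g * g₁) h * (tens (rconj g g₁) (rconj h g₁) * tens g₁ h)⁻¹)
  | tensor_conj_hat (g h k : G) :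
      IsRelator q (rconj (tens g h) (hat k) * (tens (rconj g (k ^ q)) (rconj h (k ^ q)))⁻¹)
  | hat_mul (k k₁ : G) :
      IsRelator q (hat (k * k₁) * (hat k * hatProd q k k₁ * hat k₁)⁻¹)
  | hat_comm (k k₁ : G) :
      IsRelator q (rcomm (hat k) (hat k₁) * (tens (k ^ q) (k₁ ^ q))⁻¹)
  | hat_rcomm (g h : G) :
      IsRelator q (hat (rcomm g h) * (tens g h ^ q)⁻¹)
  | hat_of_zero (hq : q = 0) (k : G) : IsRelator q (hat k)

end QTensorSquare

/-- The `q`-tensor square `G ⊗^q G` of a group `G` acting on itself by conjugation. -/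
abbrev QTensorSquare (G : Type*) [Group G] (q : ℕ) : Type _ :=
  PresentedGroup {r : FreeGroup (QTensorGen G) | QTensorSquare.IsRelator q r}

/-! Dihedral groups are generated by reflections, and an odd exponent `q` barely sees involutions:
`t ^ q = t`. Homology: in a central extension with kernel of odd exponent, reflections lift to
involutions, and the dihedral relation on their product lifts too, since its defect is both central
and inverted (`exists_section_of_odd`). So 2-cocycles are coboundaries, and the universal cocycle
into `C₂/B₂` gives `H₂ = 0`. Tensor square: hats of reflections are involutions and respect
conjugation (`hatc_rconj`), so they satisfy the dihedral relations. The resulting map from `D_n` is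
split by `eval`, and it is onto because `t ⊗ u` is the commutator of the hats of `t` and `u` for
reflections. -/

/-! ### Dihedral presentation and central extensions -/

namespace DihedralGroup

variable {n : ℕ} {H : Type*} [Group H]

/-- Two homomorphisms out of a dihedral group agree if they agree on the standard generators. -/
theorem monoidHom_ext {f g : DihedralGroup n →* H} (hr : f (r 1) = g (r 1))
    (hs : f (sr 0) = g (sr 0)) : f = g := by
  have key : ∀ i : ZMod n, f (r i) = g (r i) := fun i => by
    obtain ⟨k, rfl⟩ := ZMod.intCast_surjective i
    rw [← r_one_zpow, map_zpow, map_zpow, hr]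
  ext x
  rcases x with i | i
  · exact key i
  · have : (sr i : DihedralGroup n) = sr 0 * r i := by simp
    rw [this, map_mul, map_mul, hs, key]

/-- The universal property of the dihedral group: elements `a`, `ρ` with `a² = (aρ)² = ρⁿ = 1` are
the images of `sr 0` and `r 1` under a homomorphism. -/
theorem exists_monoidHom (a ρ : H) (ha : a * a = 1) (hb : a * ρ * (a * ρ) = 1) (hρ : ρ ^ n = 1) :
    ∃ f : DihedralGroup n →* H, f (r 1) = ρ ∧ f (sr 0) = a := by
  let L : ZMod n →+ Additive H := ZMod.lift n
    ⟨zmultiplesHom (Additive H) (Additive.ofMul ρ), by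
      simp only [zmultiplesHom_apply, natCast_zsmul, ← ofMul_pow, hρ, ofMul_one]⟩
  let R : ZMod n → H := fun i => (L i).toMul
  have R_int (k : ℤ) : R (k : ZMod n) = ρ ^ k := by
    simp only [R, L, ZMod.lift_coe, zmultiplesHom_apply, ← ofMul_zpow, toMul_ofMul]
  have R_add (i j : ZMod n) : R (i + j) = R i * R j := by simp only [R, map_add, toMul_add]
  have R_zero : R 0 = 1 := by simp only [R, map_zero, toMul_zero]
  have hinv : a * ρ * a⁻¹ = ρ⁻¹ := by
    rw [inv_eq_of_mul_eq_one_left ha, eq_inv_iff_mul_eq_one, mul_assoc (a * ρ), hb]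
  have R_conj (i : ZMod n) : R i * a = a * R (-i) := by
    obtain ⟨k, rfl⟩ := ZMod.intCast_surjective i
    rw [← Int.cast_neg, R_int, R_int, zpow_neg, ← inv_zpow, ← hinv, conj_zpow,
      inv_eq_of_mul_eq_one_left ha, mul_assoc, ← mul_assoc a a, ha, one_mul]
  refine ⟨MonoidHom.mk' (fun x => match x with | r i => R i | sr i => a * R i) ?_, ?_, ?_⟩
  · rintro (i | i) (j | j)
    · simp [R_add]
    · simp only [r_mul_sr]
      rw [← mul_assoc, R_conj, mul_assoc, ← R_add, neg_add_eq_sub]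
    · simp [R_add, mul_assoc]
    · simp only [sr_mul_sr]
      rw [mul_assoc, ← mul_assoc (R i), R_conj, mul_assoc, ← R_add, ← mul_assoc, ha, one_mul,
        neg_add_eq_sub]
  · simpa using! R_int 1
  · simp [R_zero]

/-- A central extension of a dihedral group by a kernel of odd exponent splits. -/
theorem exists_section_of_odd (p : H →* DihedralGroup n) (hp : Function.Surjective p)
    (hcentral : p.ker ≤ Subgroup.center H) {q : ℕ} (hq : Odd q)
    (hker : ∀ x ∈ p.ker, x ^ q = 1) :
    ∃ σ : DihedralGroup n →* H, p.comp σ = MonoidHom.id _ := by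
  have eq_one_of_sq {x : H} (hx : x ∈ p.ker) (h2 : x ^ 2 = 1) : x = 1 := by
    obtain ⟨m, rfl⟩ := hq
    simpa [pow_succ, pow_mul, h2] using hker x hx
  have lift_sr (i : ZMod n) : ∃ y, p y = sr i ∧ y * y = 1 := by
    obtain ⟨y, hy⟩ := hp (sr i)
    -- `y * y` lies in the kernel, so its `q`-th power is trivial; `q` odd keeps the image `sr i`.
    refine ⟨y ^ q, ?_, ?_⟩
    · obtain ⟨m, rfl⟩ := hq
      rw [map_pow, hy, pow_succ, pow_mul, pow_two, sr_mul_self, one_pow, one_mul]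
    · rw [← (Commute.refl y).mul_pow]
      exact hker _ (by simp [MonoidHom.mem_ker, hy])
  obtain ⟨a, hpa, ha⟩ := lift_sr 0
  obtain ⟨b, hpb, hb⟩ := lift_sr 1
  have hmem : (a * b) ^ n ∈ p.ker := by
    rw [MonoidHom.mem_ker, map_pow, map_mul, hpa, hpb, sr_mul_sr, sub_zero, r_one_pow_n]
  have hab : a * (a * b) = b := by rw [← mul_assoc, ha, one_mul]
  obtain ⟨σ, hσr, hσs⟩ := exists_monoidHom (n := n) a (a * b) ha (by rw [hab, hb]) (by
    apply eq_one_of_sq hmem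
    -- Centrality fixes `(a * b) ^ n` under conjugation by `a`, which inverts `a * b`; hence its
    -- square is `1`.
    have hc : a * (a * b) ^ n * a⁻¹ = (a * b) ^ n := by
      rw [mul_inv_eq_iff_eq_mul]
      exact Subgroup.mem_center_iff.1 (hcentral hmem) a
    rw [← conj_pow, hab, inv_eq_of_mul_eq_one_left ha] at hc
    have hba : b * a = (a * b)⁻¹ := by
      rw [mul_inv_rev, inv_eq_of_mul_eq_one_left ha, inv_eq_of_mul_eq_one_left hb]
    rw [hba, inv_pow] at hc
    rw [pow_two]
    nth_rewrite 1 [← hc]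
    exact inv_mul_cancel _)
  refine ⟨σ, monoidHom_ext ?_ ?_⟩
  · simp [hσr, hpa, hpb]
  · simp [hσs, hpa]

end DihedralGroup

/-! ### Cocycles and second homology -/

/-- The underlying set of the extension of `G` by `B` defined by a `2`-cocycle `c`. -/
@[ext] structure CocycleExtension {G B : Type*} (c : G → G → B) where
  fst : B
  snd : G

namespace CocycleExtension

variable {G B : Type*} [Group G] [AddCommGroup B] {c : G → G → B}

instance : Mul (CocycleExtension c) := ⟨fun x y => ⟨x.1 + y.1 + c x.2 y.2, x.2 * y.2⟩⟩

/-- The cocycle need not be normalised, hence the correction by `c 1 1`. -/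
instance : One (CocycleExtension c) := ⟨⟨-c 1 1, 1⟩⟩

instance : Inv (CocycleExtension c) := ⟨fun x => ⟨-x.1 - c x.2⁻¹ x.2 - c 1 1, x.2⁻¹⟩⟩

theorem mul_def (x y : CocycleExtension c) : x * y = ⟨x.1 + y.1 + c x.2 y.2, x.2 * y.2⟩ := rfl

theorem one_def : (1 : CocycleExtension c) = ⟨-c 1 1, 1⟩ := rfl

theorem inv_def (x : CocycleExtension c) :
    x⁻¹ = ⟨-x.1 - c x.2⁻¹ x.2 - c 1 1, x.2⁻¹⟩ := rfl

/-- The group structure on the extension defined by a `2`-cocycle for the trivial action. -/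
abbrev group (hc : ∀ g h k, c h k - c (g * h) k + c g (h * k) - c g h = 0) :
    Group (CocycleExtension c) :=
  Group.ofLeftAxioms
    (fun x y z => by
      have := hc x.2 y.2 z.2
      simp only [mul_def, CocycleExtension.mk.injEq, mul_assoc, and_true]
      rw [← sub_eq_zero] at this ⊢
      rw [← neg_eq_zero, ← this]
      abel)
    (fun x => by
      have := hc 1 1 x.2
      simp only [one_mul, sub_self, zero_add, sub_eq_zero] at this
      ext
      · simp only [one_def, mul_def, one_mul, this]; abel
      · simp [one_def, mul_def])
    (fun x => by
      ext
      · simp only [one_def, mul_def, inv_def]; abel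
      · simp [one_def, mul_def, inv_def])

end CocycleExtension

/-- A `2`-cocycle of a dihedral group with values in a trivial module of odd exponent is a
coboundary. -/
theorem DihedralGroup.exists_eq_coboundary {n q : ℕ} (hq : Odd q) {B : Type*} [AddCommGroup B]
    (hB : ∀ b : B, q • b = 0) (c : DihedralGroup n → DihedralGroup n → B)
    (hc : ∀ g h k, c h k - c (g * h) k + c g (h * k) - c g h = 0) :
    ∃ φ : DihedralGroup n → B, ∀ g h, c g h = φ (g * h) - φ g - φ h := by
  let := CocycleExtension.group hc
  let p : CocycleExtension c →* DihedralGroup n := MonoidHom.mk' (fun x => x.2) fun _ _ => rfl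
  have c_one_left (g) : c 1 g = c 1 1 := by
    have := hc 1 1 g
    simpa [sub_eq_zero] using this
  have c_one_right (g) : c g 1 = c 1 1 := by
    have := hc g 1 1
    simpa [sub_eq_zero, eq_comm (a := c g 1)] using this
  -- Shifting the first coordinate by `c 1 1` identifies the kernel with `B`.
  have hpow (x : CocycleExtension c) (hx : x.2 = 1) (k : ℕ) :
      x ^ k = ⟨k • (x.1 + c 1 1) - c 1 1, 1⟩ := by
    induction k with
    | zero => simp [CocycleExtension.one_def]
    | succ k ih =>
      rw [pow_succ, ih, CocycleExtension.mul_def]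
      ext
      · simp only [hx, add_smul, one_smul]; abel
      · simp [hx]
  obtain ⟨σ, hσ⟩ := DihedralGroup.exists_section_of_odd p (fun g => ⟨⟨0, g⟩, rfl⟩)
    (fun x hx => Subgroup.mem_center_iff.2 fun y => by
      have hx : x.2 = 1 := hx
      simp only [CocycleExtension.mul_def, hx, c_one_left, c_one_right, one_mul, mul_one,
        add_comm x.1])
    hq (fun x hx => by
      have hx : x.2 = 1 := hx
      rw [hpow x hx, hB, zero_sub]
      rfl)
  have hσ' (g) : (σ g).2 = g := DFunLike.congr_fun hσ g
  refine ⟨fun g => (σ g).1, fun g h => ?_⟩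
  have := congrArg CocycleExtension.fst (σ.map_mul g h)
  rw [CocycleExtension.mul_def] at this
  simp only [hσ'] at this
  change c g h = (σ (g * h)).fst - (σ g).fst - (σ h).fst
  rw [this]
  abel

/-- If every `2`-cocycle of `G` with values in the trivial modules `V →+ M` is a coboundary, then
the second homology of `G` with coefficients in the trivial module `V` vanishes. -/
theorem subsingleton_groupHomology_two_trivial {G V : Type} [Group G] [AddCommGroup V]
    (H : ∀ (M : Type) [AddCommGroup M] (c : G → G → V →ₗ[ℤ] M),
      (∀ g h k, c h k - c (g * h) k + c g (h * k) - c g h = 0) →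
      ∃ φ : G → V →ₗ[ℤ] M, ∀ g h, c g h = φ (g * h) - φ g - φ h) :
    Subsingleton (groupHomology (Rep.trivial ℤ G V) 2) := by
  let A := Rep.trivial ℤ G V
  let P : (G × G →₀ V) →ₗ[ℤ] (G × G →₀ V) ⧸ groupHomology.boundaries₂ A :=
    (groupHomology.boundaries₂ A).mkQ
  -- The universal cocycle: its cocycle identity is the vanishing of `d₃₂` modulo boundaries.
  obtain ⟨φ, hφ⟩ := H ((G × G →₀ V) ⧸ groupHomology.boundaries₂ A)
    (fun g h => P ∘ₗ Finsupp.lsingle (g, h)) (fun g h k => by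
      ext v
      have : groupHomology.d₃₂ A (Finsupp.single (g, h, k) v) ∈ groupHomology.boundaries₂ A :=
        ⟨_, rfl⟩
      rw [groupHomology.d₃₂_single] at this
      have h0 := (Submodule.Quotient.mk_eq_zero _).2 this
      exact h0)
  let Ψ : (G →₀ V) →ₗ[ℤ] (G × G →₀ V) ⧸ groupHomology.boundaries₂ A :=
    Finsupp.lsum ℤ fun g => -φ g
  -- `P` factors through `d₂₁`, so it kills cycles.
  have hP : P = Ψ ∘ₗ (groupHomology.d₂₁ A).hom := by
    apply Finsupp.lhom_ext
    rintro ⟨g, h⟩ v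
    have h1 := LinearMap.congr_fun (hφ g h) v
    have h2 : (groupHomology.d₂₁ A).hom (Finsupp.single (g, h) v) =
      (Finsupp.single h v - Finsupp.single (g * h) v + Finsupp.single g v : G →₀ V) :=
      groupHomology.d₂₁_single (A := A) (g, h) v
    refine h1.trans ?_
    rw [LinearMap.comp_apply, h2]
    simp only [Ψ, map_add, map_sub, Finsupp.lsum_single, LinearMap.sub_apply, LinearMap.neg_apply]
    abel
  refine subsingleton_of_forall_eq 0 fun x => ?_
  induction x using groupHomology.H2_induction_on with
  | h z =>
    rw [groupHomology.H2π_eq_zero_iff]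
    refine (Submodule.Quotient.mk_eq_zero _).1 ?_
    change P z.1 = 0
    rw [hP, LinearMap.comp_apply]
    have hz : (groupHomology.d₂₁ A).hom z.1 = 0 := z.2
    rw [hz, map_zero]

theorem DihedralGroup.subsingleton_groupHomology_two (n : ℕ) {q : ℕ} (hq : Odd q) :
    Subsingleton (groupHomology (Rep.trivial ℤ (DihedralGroup n) (ZMod q)) 2) :=
  subsingleton_groupHomology_two_trivial fun _ _ c hc =>
    DihedralGroup.exists_eq_coboundary hq (fun b => by
      ext
      simp [← map_nsmul]) c hc

/-! ### Conjugation and involutions -/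

section Conj

variable {G : Type*} [Group G]

theorem rconj_mul (x y z : G) : rconj (x * y) z = rconj x z * rconj y z := by
  simp [rconj, mul_assoc]

theorem rconj_rconj (x y z : G) : rconj (rconj x y) z = rconj x (y * z) := by
  simp [rconj, mul_assoc]

theorem rconj_pow (x z : G) (k : ℕ) : rconj (x ^ k) z = rconj x z ^ k := by
  simpa [rconj] using (conj_pow (a := z⁻¹) (b := x) (i := k)).symm

theorem rconj_zpow (x z : G) (k : ℤ) : rconj (x ^ k) z = rconj x z ^ k := by
  simpa [rconj] using (conj_zpow (a := z⁻¹) (b := x) (i := k)).symm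

theorem map_rconj {H : Type*} [Group H] (f : G →* H) (x y : G) :
    f (rconj x y) = rconj (f x) (f y) := by simp [rconj]

theorem map_rcomm {H : Type*} [Group H] (f : G →* H) (x y : G) :
    f (rcomm x y) = rcomm (f x) (f y) := by simp [rcomm]

theorem rconj_mul_self {t u : G} (ht : t * t = 1) : rconj t u * rconj t u = 1 := by
  rw [← rconj_mul, ht]; simp [rconj]

end Conj

theorem pow_of_odd_of_mul_self {G : Type*} [Group G] {q : ℕ} (hq : Odd q) {t : G}
    (ht : t * t = 1) : t ^ q = t := by
  obtain ⟨m, rfl⟩ := hq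
  rw [pow_succ, pow_mul, pow_two, ht, one_pow, one_mul]

theorem pow_of_even_of_mul_self {G : Type*} [Group G] {q : ℕ} (hq : Even q) {t : G}
    (ht : t * t = 1) : t ^ q = 1 := by
  obtain ⟨m, rfl⟩ := hq
  rw [← two_mul, pow_mul, pow_two, ht, one_pow]

/-! ### Relations and evaluation of the tensor square -/

namespace QTensorSquare

variable {G : Type*} [Group G] (q : ℕ)

/-- The class of the symbol `g ⊗ h` in the `q`-tensor square. -/
def tensor (g h : G) : QTensorSquare G q := PresentedGroup.of (QTensorGen.tensor g h)

/-- The class of the symbol `k̂` in the `q`-tensor square. -/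
def hatc (k : G) : QTensorSquare G q := PresentedGroup.of (QTensorGen.hat k)

theorem tensor_mul (g h h₁ : G) :
    tensor q g (h * h₁) = tensor q g h₁ * tensor q (rconj g h₁) (rconj h h₁) := by
  have := PresentedGroup.mk_eq_mk_of_mul_inv_mem
    (rels := {r | IsRelator q r}) (IsRelator.tensor_mul (q := q) g h h₁)
  rwa [map_mul] at this

theorem mul_tensor (g g₁ h : G) :
    tensor q (g * g₁) h = tensor q (rconj g g₁) (rconj h g₁) * tensor q g₁ h := by
  have := PresentedGroup.mk_eq_mk_of_mul_inv_mem
    (rels := {r | IsRelator q r}) (IsRelator.mul_tensor (q := q) g g₁ h)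
  rwa [map_mul] at this

theorem rconj_tensor_hatc (g h k : G) :
    rconj (tensor q g h) (hatc q k) = tensor q (rconj g (k ^ q)) (rconj h (k ^ q)) := by
  have := PresentedGroup.mk_eq_mk_of_mul_inv_mem
    (rels := {r | IsRelator q r}) (IsRelator.tensor_conj_hat (q := q) g h k)
  rwa [map_rconj] at this

theorem hatc_mul (k k₁ : G) :
    hatc q (k * k₁) = hatc q k * ((List.range (q - 1)).map fun j =>
      tensor q k (rconj ((k₁ ^ (j + 1))⁻¹) (k ^ (q - 1 - (j + 1))))).prod * hatc q k₁ := by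
  have := PresentedGroup.mk_eq_mk_of_mul_inv_mem
    (rels := {r | IsRelator q r}) (IsRelator.hat_mul (q := q) k k₁)
  rw [map_mul, map_mul, hatProd, map_list_prod, List.map_map] at this
  exact this

theorem rcomm_hatc (k k₁ : G) : rcomm (hatc q k) (hatc q k₁) = tensor q (k ^ q) (k₁ ^ q) := by
  have := PresentedGroup.mk_eq_mk_of_mul_inv_mem
    (rels := {r | IsRelator q r}) (IsRelator.hat_comm (q := q) k k₁)
  rwa [map_rcomm] at this

theorem hatc_rcomm (g h : G) : hatc q (rcomm g h) = tensor q g h ^ q := by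
  have := PresentedGroup.mk_eq_mk_of_mul_inv_mem
    (rels := {r | IsRelator q r}) (IsRelator.hat_rcomm (q := q) g h)
  rwa [map_pow] at this

theorem tensor_one (g : G) : tensor q g 1 = 1 := by
  have := tensor_mul q g 1 1
  simpa [rconj] using this

theorem one_tensor (h : G) : tensor q 1 h = 1 := by
  have := mul_tensor q 1 1 h
  simpa [rconj] using this

theorem hatc_one : hatc q (1 : G) = 1 := by
  have := hatc_mul q (1 : G) 1
  simpa [one_tensor] using this

section Eval

/-- Expanding `(k k₁)ᵐ⁺¹` into powers of `k` and `k₁` and commutators. -/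
theorem mul_pow_eq_prod_rcomm (k k₁ : G) (m : ℕ) :
    (k * k₁) ^ (m + 1) = k ^ (m + 1) * ((List.range m).map fun j =>
      rcomm k (rconj ((k₁ ^ (j + 1))⁻¹) (k ^ (m - (j + 1))))).prod * k₁ ^ (m + 1) := by
  -- Closed form of the telescoping partial products.
  have key : ∀ i ≤ m, k ^ (m + 1) * ((List.range i).map fun j =>
      rcomm k (rconj ((k₁ ^ (j + 1))⁻¹) (k ^ (m - (j + 1))))).prod =
      (k * k₁) ^ i * k * (k₁ ^ i)⁻¹ * k ^ (m - i) := by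
    intro i
    induction i with
    | zero => simp [pow_succ']
    | succ i ih =>
      intro hi
      rw [List.range_succ, List.map_append, List.prod_append, ← mul_assoc, ih (by omega)]
      obtain ⟨e, rfl⟩ := Nat.exists_eq_add_of_le hi
      have h1 : i + 1 + e - i = e + 1 := by omega
      have h2 : i + 1 + e - (i + 1) = e := by omega
      simp only [h1, h2, List.map_cons, List.map_nil, List.prod_singleton, rcomm, rconj]
      simp only [pow_succ, mul_inv_rev, inv_inv, mul_assoc, mul_inv_cancel_left,
        inv_mul_cancel_left]
      simp only [← mul_assoc]
      simp only [← pow_succ, mul_assoc]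
      rw [pow_succ' k e, mul_assoc k, mul_inv_cancel_left]
  rw [key m le_rfl, Nat.sub_self, pow_zero, mul_one, pow_succ k₁, ← mul_assoc,
    inv_mul_cancel_right, pow_succ, mul_assoc]

/-- The homomorphism `g ⊗ h ↦ [g, h]`, `k̂ ↦ k ^ q`. -/
def eval (hq : q ≠ 0) : QTensorSquare G q →* G :=
  PresentedGroup.toGroup (f := fun x => match x with
    | QTensorGen.tensor g h => rcomm g h
    | QTensorGen.hat k => k ^ q) <| by
  have ht (g h : G) : FreeGroup.lift (fun x : QTensorGen G => match x with
    | QTensorGen.tensor g h => rcomm g h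
    | QTensorGen.hat k => k ^ q) (tens g h) = rcomm g h := FreeGroup.lift_apply_of
  have hh (k : G) : FreeGroup.lift (fun x : QTensorGen G => match x with
    | QTensorGen.tensor g h => rcomm g h
    | QTensorGen.hat k => k ^ q) (hat k) = k ^ q := FreeGroup.lift_apply_of
  rintro _ (⟨g, h, h₁⟩ | ⟨g, g₁, h⟩ | ⟨g, h, k⟩ | ⟨k, k₁⟩ | ⟨k, k₁⟩ | ⟨g, h⟩ | ⟨h0, -⟩)
  · rw [map_mul, map_inv, map_mul, ht, ht, ht, mul_inv_eq_one]
    simp [rcomm, rconj, mul_assoc]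
  · rw [map_mul, map_inv, map_mul, ht, ht, ht, mul_inv_eq_one]
    simp [rcomm, rconj, mul_assoc]
  · rw [map_mul, map_inv, map_rconj, ht, ht, hh, mul_inv_eq_one]
    simp [rcomm, rconj, mul_assoc]
  · obtain ⟨m, rfl⟩ := Nat.exists_eq_succ_of_ne_zero hq
    rw [map_mul, map_inv, map_mul, map_mul, hatProd, map_list_prod, List.map_map, hh, hh, hh,
      mul_inv_eq_one, Nat.succ_eq_add_one, mul_pow_eq_prod_rcomm]
    congr 3
    exact List.map_congr_left fun j _ => (ht _ _).symm
  · rw [map_mul, map_inv, map_rcomm, ht, hh, hh, mul_inv_eq_one]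
  · rw [map_mul, map_inv, map_pow, ht, hh, mul_inv_eq_one]
  · exact absurd h0 hq

theorem eval_hatc (hq : q ≠ 0) (k : G) : eval q hq (hatc q k) = k ^ q :=
  PresentedGroup.toGroup.of _

end Eval

/-! ### Tensors and hats of involutions -/

section Involutions

variable {q} {t u : G}

/-- Expanding `t ⊗ t² = 1` kills the square; the hat of `[t, t] = 1` kills the odd power `q`. -/
theorem tensor_self_of_involution (hq : Odd q) (ht : t * t = 1) : tensor q t t = 1 := by
  have h2 : tensor q t t ^ 2 = 1 := by
    have := tensor_mul q t t t
    rw [ht, tensor_one] at this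
    rw [pow_two, this]; simp [rconj]
  have hq' : tensor q t t ^ q = 1 := by
    rw [← hatc_rcomm]; simp [rcomm, hatc_one]
  obtain ⟨m, rfl⟩ := hq
  simpa [pow_succ, pow_mul, h2] using hq'

theorem hatc_mul_self (hq : Odd q) (ht : t * t = 1) : hatc q t * hatc q t = 1 := by
  have := hatc_mul q t t
  rw [ht, hatc_one, List.prod_eq_one, mul_one] at this
  · exact this.symm
  · simp only [List.mem_map, List.mem_range, forall_exists_index, and_imp]
    rintro _ j - rfl
    have : rconj ((t ^ (j + 1))⁻¹) (t ^ (q - 1 - (j + 1))) = (t ^ (j + 1))⁻¹ := by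
      have : Commute (t ^ (j + 1))⁻¹ (t ^ (q - 1 - (j + 1))) :=
        ((Commute.refl t).pow_pow _ _).inv_left
      rw [rconj, mul_assoc, this.eq, inv_mul_cancel_left]
    rw [this]
    rcases Nat.even_or_odd (j + 1) with hj | hj
    · rw [pow_of_even_of_mul_self hj ht, inv_one, tensor_one]
    · rw [pow_of_odd_of_mul_self hj ht, inv_eq_of_mul_eq_one_left ht,
        tensor_self_of_involution hq ht]

theorem tensor_eq_rcomm (hq : Odd q) (ht : t * t = 1) (hu : u * u = 1) :
    tensor q t u = rcomm (hatc q t) (hatc q u) := by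
  rw [rcomm_hatc, pow_of_odd_of_mul_self hq ht, pow_of_odd_of_mul_self hq hu]

theorem tensor_rconj_involution (hq : Odd q) (hu : u * u = 1) (g h : G) :
    tensor q (rconj g u) (rconj h u) = rconj (tensor q g h) (hatc q u) := by
  rw [rconj_tensor_hatc, pow_of_odd_of_mul_self hq hu]

theorem rconj_rcomm_left {H : Type*} [Group H] {a b : H} (ha : a * a = 1) (hb : b * b = 1) :
    rconj (rcomm a b) a = (rcomm a b)⁻¹ := by
  simp only [rconj, rcomm, mul_inv_rev, inv_eq_of_mul_eq_one_left ha,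
    inv_eq_of_mul_eq_one_left hb, mul_assoc]
  simp only [← mul_assoc, ha, one_mul]

theorem rconj_rcomm_right {H : Type*} [Group H] {a b : H} (ha : a * a = 1) (hb : b * b = 1) :
    rconj (rcomm a b) b = (rcomm a b)⁻¹ := by
  simp only [rconj, rcomm, mul_inv_rev, inv_eq_of_mul_eq_one_left ha,
    inv_eq_of_mul_eq_one_left hb, mul_assoc, hb, mul_one]

theorem tensor_rconj_left (hq : Odd q) (ht : t * t = 1) (hu : u * u = 1) :
    tensor q t (rconj u t) = (tensor q t u)⁻¹ := by
  have := tensor_rconj_involution hq ht t u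
  rw [tensor_eq_rcomm hq ht hu,
    rconj_rcomm_left (hatc_mul_self hq ht) (hatc_mul_self hq hu)] at this
  rw [tensor_eq_rcomm hq ht hu, ← this]
  simp [rconj]

/-- Conjugating by the hats of `t` and `u` inverts `t ⊗ u` twice, so splitting off one `t * u` adds
one factor. -/
theorem tensor_mul_pow (hq : Odd q) (ht : t * t = 1) (hu : u * u = 1) (k : ℕ) :
    tensor q t ((t * u) ^ k) = tensor q t u ^ k := by
  have h1 : tensor q t (t * u) = tensor q t u := by
    rw [tensor_mul, tensor_self_of_involution hq (rconj_mul_self ht), mul_one]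
  induction k with
  | zero => simp [tensor_one]
  | succ k ih =>
    rw [pow_succ, tensor_mul, h1, ← rconj_rconj, ← rconj_rconj _ t,
      tensor_rconj_involution hq hu, tensor_rconj_involution hq ht, ih, rconj_pow, rconj_pow,
      tensor_eq_rcomm hq ht hu, rconj_rcomm_left (hatc_mul_self hq ht) (hatc_mul_self hq hu)]
    have : rconj (rcomm (hatc q t) (hatc q u))⁻¹ (hatc q u) = rcomm (hatc q t) (hatc q u) := by
      rw [← zpow_neg_one, rconj_zpow,
        rconj_rcomm_right (hatc_mul_self hq ht) (hatc_mul_self hq hu), zpow_neg_one, inv_inv]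
    rw [this, pow_succ']

theorem tensor_mul_pow_inv (hq : Odd q) (ht : t * t = 1) (hu : u * u = 1) (k : ℕ) :
    tensor q t (((t * u) ^ k)⁻¹) = (tensor q t u ^ k)⁻¹ := by
  have : (t * u)⁻¹ = t * rconj u t := by
    rw [rconj, mul_inv_rev, inv_eq_of_mul_eq_one_left hu, mul_assoc, mul_inv_cancel_left,
      inv_eq_of_mul_eq_one_left ht]
  rw [← inv_pow, this, tensor_mul_pow hq ht (rconj_mul_self hu), tensor_rconj_left hq ht hu,
    inv_pow]

/-- Each consecutive pair of factors contributes `x⁻²`. -/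
theorem prod_alternating_pow {H : Type*} [Group H] (x : H) (m : ℕ) :
    ((List.range (2 * m)).map fun j =>
      if Even j then x ^ (2 * (j + 1)) else (x ^ (2 * (j + 1)))⁻¹).prod = (x ^ (2 * m))⁻¹ := by
  induction m with
  | zero => simp
  | succ m ih =>
    rw [show 2 * (m + 1) = 2 * m + 1 + 1 by ring, List.range_succ, List.range_succ,
      List.append_assoc, List.map_append, List.prod_append, ih]
    simp only [List.map_append, List.map_cons, List.map_nil, List.prod_append,
      List.prod_singleton, if_pos (even_two_mul m),
      if_neg (Nat.not_even_iff_odd.2 (odd_two_mul_add_one m))]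
    simp only [← zpow_natCast, ← zpow_neg, ← zpow_add]
    congr 1
    push_cast
    ring

/-- On involutions, `k ↦ k̂` is compatible with conjugation. -/
theorem hatc_rconj (hq : Odd q) (ht : t * t = 1) (hu : u * u = 1) :
    hatc q (rconj t u) = rconj (hatc q t) (hatc q u) := by
  have hw : rcomm t u = (t * u) ^ 2 := by
    rw [rcomm, inv_eq_of_mul_eq_one_left ht, inv_eq_of_mul_eq_one_left hu, pow_two, mul_assoc]
  have hwt (k : ℕ) : rconj (((t * u) ^ k)⁻¹) t = (t * u) ^ k := by
    rw [← inv_pow, rconj_pow]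
    congr 1
    rw [rconj, mul_inv_rev, inv_eq_of_mul_eq_one_left ht, inv_eq_of_mul_eq_one_left hu,
      mul_assoc, mul_assoc, ht, mul_one]
  have h1 : rconj t u = t * rcomm t u := by simp [rconj, rcomm, mul_assoc]
  -- Conjugation by `t` inverts `[t, u] = (t * u) ^ 2`, and `q - 1` is even, so the parity of `j`
  -- fixes the sign of the exponent.
  have hprod : ((List.range (q - 1)).map fun j =>
      tensor q t (rconj ((rcomm t u ^ (j + 1))⁻¹) (t ^ (q - 1 - (j + 1))))).prod =
      (tensor q t u ^ (q - 1))⁻¹ := by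
    obtain ⟨m, hm⟩ := hq
    have hm' : q - 1 = 2 * m := by omega
    rw [hm', ← prod_alternating_pow]
    congr 1
    refine List.map_congr_left fun j hj => ?_
    rw [List.mem_range] at hj
    rw [hw, ← pow_mul]
    have hq : Odd q := ⟨m, hm⟩
    split_ifs with h
    · rw [pow_of_odd_of_mul_self (q := 2 * m - (j + 1)) _ ht, hwt, tensor_mul_pow hq ht hu]
      rw [Nat.odd_sub (by omega)]
      simp [Nat.even_add_one, h]
    · rw [pow_of_even_of_mul_self (q := 2 * m - (j + 1)) _ ht]
      · rw [rconj, inv_one, one_mul, mul_one, tensor_mul_pow_inv hq ht hu]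
      · rw [Nat.even_sub (by omega)]
        simp [Nat.even_add_one, h]
  have hx : (tensor q t u ^ (q - 1))⁻¹ * tensor q t u ^ q = tensor q t u := by
    rw [inv_mul_eq_iff_eq_mul, ← pow_succ, Nat.sub_add_cancel hq.pos]
  rw [h1, hatc_mul, hprod, hatc_rcomm, mul_assoc, hx, tensor_eq_rcomm hq ht hu]
  simp [rconj, rcomm, mul_assoc]

end Involutions

/-! ### The tensor square of a dihedral group -/

section Dihedral

open DihedralGroup

variable {n q : ℕ}

/-- `sr (i + 2)` is `sr i` conjugated by `sr (i + 1)`, so the induction carries two consecutive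
reflections. -/
theorem hatc_sr_natCast (hq : Odd q) (i : ℕ) :
    hatc q (sr (i : ZMod n)) = hatc q (sr 0) * (hatc q (sr 0) * hatc q (sr 1)) ^ i ∧
    hatc q (sr ((i + 1 : ℕ) : ZMod n)) =
      hatc q (sr 0) * (hatc q (sr 0) * hatc q (sr 1)) ^ (i + 1) := by
  have hsq (i : ZMod n) : hatc q (sr i) * hatc q (sr i) = 1 := hatc_mul_self hq (sr_mul_self i)
  induction i with
  | zero => simp [← mul_assoc, hsq]
  | succ i ih =>
    refine ⟨ih.2, ?_⟩
    have h : (sr ((i + 1 + 1 : ℕ) : ZMod n)) =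
        rconj (sr ((i : ℕ) : ZMod n)) (sr ((i + 1 : ℕ) : ZMod n)) := by
      simp only [rconj, inv_sr, sr_mul_sr, r_mul_sr]
      congr 1
      push_cast
      ring
    rw [h, hatc_rconj hq (sr_mul_self _) (sr_mul_self _), rconj,
      inv_eq_of_mul_eq_one_left (hsq _), ih.2, ih.1]
    generalize hρ : hatc q (sr (0 : ZMod n)) * hatc q (sr 1) = ρ
    have h0 : hatc q (sr (0 : ZMod n)) * hatc q (sr 0) = 1 := hsq 0
    have h1 := hsq ((i : ℕ) : ZMod n)
    rw [ih.1, hρ] at h1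
    have : hatc q (sr (0 : ZMod n)) * ρ ^ (i + 1) * (hatc q (sr 0) * ρ ^ i) *
        (hatc q (sr 0) * ρ ^ (i + 1)) = hatc q (sr 0) * ρ ^ (i + 1) *
        ((hatc q (sr 0) * ρ ^ i) * (hatc q (sr 0) * ρ ^ i)) * ρ := by
      simp only [pow_succ, mul_assoc]
    rw [this, h1, mul_one, pow_succ ρ (i + 1), mul_assoc]

theorem nonempty_mulEquiv_dihedralGroup (hn : n ≠ 0) (hq : Odd q) :
    Nonempty (QTensorSquare (DihedralGroup n) q ≃* DihedralGroup n) := by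
  have : NeZero n := ⟨hn⟩
  have hsq (i : ZMod n) : hatc q (sr i) * hatc q (sr i) = 1 := hatc_mul_self hq (sr_mul_self i)
  obtain ⟨f, hfr, hfs⟩ := exists_monoidHom (n := n) (hatc q (sr (0 : ZMod n)))
    (hatc q (sr 0) * hatc q (sr 1)) (hsq 0) (by
      rw [← mul_assoc (hatc q (sr (0 : ZMod n))), hsq, one_mul, hsq]) (by
      -- At `i = n` the reflection is again `sr 0`, which forces `ρ ^ n = 1`.
      have := (hatc_sr_natCast (n := n) hq n).1
      rwa [ZMod.natCast_self, left_eq_mul] at this)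
  let π := eval (G := DihedralGroup n) q hq.pos.ne'
  have hπf : π.comp f = MonoidHom.id _ := by
    have hπ (i : ZMod n) : π (hatc q (sr i)) = sr i := by
      rw [eval_hatc, pow_of_odd_of_mul_self hq (sr_mul_self i)]
    refine monoidHom_ext ?_ ?_
    · simp [hfr, hπ]
    · simp [hfs, hπ]
  have hsr (i : ZMod n) : hatc q (sr i) ∈ f.range := by
    obtain ⟨k, rfl⟩ := ZMod.natCast_zmod_surjective i
    rw [(hatc_sr_natCast hq k).1, ← hfr, ← hfs]
    exact mul_mem (MonoidHom.mem_range.2 ⟨_, rfl⟩) (pow_mem (MonoidHom.mem_range.2 ⟨_, rfl⟩) _)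
  have htsr (i j : ZMod n) : tensor q (sr i) (sr j) ∈ f.range := by
    rw [tensor_eq_rcomm hq (sr_mul_self i) (sr_mul_self j)]
    exact mul_mem (mul_mem (mul_mem (inv_mem (hsr i)) (inv_mem (hsr j))) (hsr i)) (hsr j)
  -- Writing rotations as products of reflections reduces all symbols to reflections, whose
  -- conjugates are reflections.
  have hr (i : ZMod n) : (r i : DihedralGroup n) = sr 0 * sr i := by simp
  have ht1 (i : ZMod n) (h : DihedralGroup n) : tensor q (sr i) h ∈ f.range := by
    rcases h with j | j
    · rw [hr, tensor_mul]
      exact mul_mem (htsr _ _) (htsr _ _)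
    · exact htsr i j
  have ht (g h : DihedralGroup n) : tensor q g h ∈ f.range := by
    rcases g with i | i
    · rw [hr, mul_tensor]
      exact mul_mem (ht1 _ _) (ht1 _ _)
    · exact ht1 i h
  have hf : Function.Surjective f := fun x => by
    refine PresentedGroup.generated_by _ f.range ?_ x
    rintro (⟨g, h⟩ | ⟨i | i⟩)
    · exact ht g h
    · change hatc q (r i) ∈ f.range
      rw [hr, hatc_mul]
      refine mul_mem (mul_mem (hsr _) (Subgroup.list_prod_mem _ ?_)) (hsr _)
      simp only [List.mem_map, forall_exists_index, and_imp]
      rintro _ j - rfl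
      exact ht _ _
    · exact hsr i
  have hinj : Function.Injective f :=
    Function.LeftInverse.injective (g := π) fun x => DFunLike.congr_fun hπf x
  exact ⟨(MulEquiv.ofBijective f ⟨hinj, hf⟩).symm⟩

end Dihedral

end QTensorSquare

theorem mainTheorem3 (n q : ℕ) (hn : 1 ≤ n) (hq : Odd q) :
    Nonempty (QTensorSquare (DihedralGroup n) q ≃* DihedralGroup n) ∧
      Subsingleton (groupHomology (Rep.trivial ℤ (DihedralGroup n) (ZMod q)) 2) :=
  ⟨QTensorSquare.nonempty_mulEquiv_dihedralGroup (Nat.one_le_iff_ne_zero.1 hn) hq,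
    DihedralGroup.subsingleton_groupHomology_two n hq⟩
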